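/- Let $M$ be a compact (Hausdorff, boundaryless) smooth manifold of dimension $n$ with a Poisson bracket $\{\,,\}$ on $C^\infty(M)$, all of whose symplectic leaves have codimension $\ge 1$, and let $\lambda\in C^\infty(M)$ be a non-constant Casimir function, i.e. $\{\lambda,g\}=0$ for all $g\in C^\infty(M)$. Let $\mathrm{Dens}$ be the set of smooth positive densities $d\nu$ on $M$ of total integral $1$ (normalized positive volume forms when $M$ is oriented), let $F_f(d\nu)=\int_M f\,d\nu$ for $f\in C^\infty(M)$, and let $\{F_f,F_g\}_{\mathrm{Dens}}=F_{\{f,g\}}$. The symplectic leaf of $d\nu$ in $\mathrm{Dens}$ is the set of densities which can be joined to $d\nu$ by finitely many arcs of Hamiltonian curves, i.e. curves $d\nu_t$ with $\frac{d}{dt}F_g(d\nu_t)=\{F_g,F_{f_t}\}_{\mathrm{Dens}}(d\nu_t)$ for all $g\in C^\infty(M)$, where $f_t$ is a smooth family of functions on $M$. For $h:\mathbb R\to\mathbb R$ put $$C_{h,\lambda}(d\nu)=\int_M (h\circ\lambda)\,d\nu .$$ Then $\mathrm{Dens}$ is non-empty and: 1. For every function $h:\mathbb R\to\mathbb R$,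 $C_{h,\lambda}$ is a Casimir of $\{\,,\}_{\mathrm{Dens}}$, i.e. it is constant on the symplectic leaves of $\mathrm{Dens}$; it is also constant on the orbits in $\mathrm{Dens}$ of the group of Hamiltonian diffeomorphisms of $M$ (the group generated by the flows of smooth, possibly time-dependent, Hamiltonians). Precisely: if $d\nu,d\nu'$ lie on one leaf or one orbit, then $h\circ\lambda$ is integrable for $d\nu$ if and only if it is for $d\nu'$, and $C_{h,\lambda}(d\nu)=C_{h,\lambda}(d\nu')$ (an integral being read as $0$ when it does not exist). 2. If $h$ is Borel and bounded on compact sets (for instance continuous), $h\circ\lambda$ is integrable for every $d\nu\in\mathrm{Dens}$. 3. If $h$ is smooth, $C_{h,\lambda}$ is one of the functionals $F_f$, and $\{C_{h,\lambda},F_g\}_{\mathrm{Dens}}=0$ for all $g\in C^\infty(M)$. 4. If $\lambda$ is not locally constant (automatic when $M$ is connected), infinitely many of these Casimirs are functionally independent: there are smooth $h_0,h_1,h_2,\dots:\mathbb R\to\mathbb R$ such that at every $d\nu\in\mathrm{Dens}$ the differentials of $C_{h_0,\lambda},C_{h_1,\lambda},\dots$ exist and are linearly independent. Here the differential at $d\nu$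 is the linear functional on $\{u\in C^\infty(M):\int_M u\,d\nu=0\}$ whose value at $u$ is the derivative at $t=0$ along the curve $(1+tu)\,d\nu$. -/

import Mathlib

open Set Filter Topology MeasureTheory
open scoped Manifold ContDiff

noncomputable section

namespace PoissonDens

/-- Real-valued smooth functions on an `n`-dimensional manifold `M` without boundary. -/
abbrev Smooth (n : ℕ) (M : Type*) [TopologicalSpace M]
    [ChartedSpace (EuclideanSpace ℝ (Fin n)) M] : Type _ :=
  ContMDiffMap (𝓡 n) 𝓘(ℝ, ℝ) M ℝ ∞

/-- A Poisson bracket on `C^∞(M)`: an `ℝ`-bilinear Lie bracket which is a derivation in each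
argument. -/
structure PoissonBracket (n : ℕ) (M : Type*) [TopologicalSpace M]
    [ChartedSpace (EuclideanSpace ℝ (Fin n)) M] where
  /-- the bracket `{f, g}` -/
  bracket : Smooth n M →ₗ[ℝ] Smooth n M →ₗ[ℝ] Smooth n M
  skew : ∀ f g, bracket f g = - bracket g f
  leibniz : ∀ f g h, bracket f (g * h) = bracket f g * h + g * bracket f h
  jacobi : ∀ f g h,
    bracket f (bracket g h) + bracket g (bracket h f) + bracket h (bracket f g) = 0

/-- A smooth probability density (normalized positive volume form) on `M`, regarded as a measure:
in every chart of the smooth structure it has a smooth positive density with respect to Lebesgue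
measure, and its total mass is `1`. -/
@[ext]
structure Dens (n : ℕ) (M : Type*) [TopologicalSpace M]
    [ChartedSpace (EuclideanSpace ℝ (Fin n)) M] [MeasurableSpace M] where
  /-- the underlying measure -/
  measure : Measure M
  smooth_pos : ∀ e ∈ IsManifold.maximalAtlas (𝓡 n) ∞ M,
    ∃ ρ : EuclideanSpace ℝ (Fin n) → ℝ, ContDiffOn ℝ ∞ ρ e.target ∧
      (∀ y ∈ e.target, 0 < ρ y) ∧
      ∀ s ⊆ e.source, MeasurableSet s → measure s = ∫⁻ y in e '' s, ENNReal.ofReal (ρ y)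
  mass_one : measure univ = 1

section

variable {n : ℕ} {M : Type*} [TopologicalSpace M] [ChartedSpace (EuclideanSpace ℝ (Fin n)) M]

namespace PoissonBracket

/-- The tangent space at `x` of the symplectic leaf through `x`: all values `X_f(x)` of Hamiltonian
vector fields, where `X_f` acts on functions by the bracket with `f`. -/
def leafTangent (P : PoissonBracket n M) (x : M) : Submodule ℝ (TangentSpace (𝓡 n) x) where
  carrier := {v | ∃ f : Smooth n M, ∀ g : Smooth n M,
    P.bracket f g x = mfderiv (𝓡 n) 𝓘(ℝ, ℝ) g x v}
  zero_mem' := ⟨0, fun g => by rw [map_zero, map_zero]; rfl⟩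
  add_mem' := by
    rintro v w ⟨f, hf⟩ ⟨f', hf'⟩
    refine ⟨f + f', fun g => ?_⟩
    rw [map_add, map_add, ← hf g, ← hf' g]
    rfl
  smul_mem' := by
    rintro c v ⟨f, hf⟩
    refine ⟨c • f, fun g => ?_⟩
    rw [map_smul, map_smul, ← hf g]
    rfl

/-- The codimension in `M` of the symplectic leaf through `x`. -/
def leafCodim (P : PoissonBracket n M) (x : M) : ℕ :=
  n - Module.finrank ℝ (P.leafTangent x)

/-- `l` is a Casimir function on `M`: its Hamiltonian vector field vanishes identically. -/
def IsCasimir (P : PoissonBracket n M) (l : Smooth n M) : Prop :=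
  ∀ g : Smooth n M, P.bracket l g = 0

/-- `φ` is the flow, starting at the identity, of the Hamiltonian vector fields of the smooth
(possibly time-dependent) Hamiltonian `f`: one has `d/dt g(φ_t x) = {g, f_t}(φ_t x)`
for all smooth `g`. -/
structure IsHamiltonianFlow (P : PoissonBracket n M) (f : ℝ → Smooth n M) (φ : ℝ → M ≃ₜ M) :
    Prop where
  smooth_ham : ContMDiff (𝓘(ℝ, ℝ).prod (𝓡 n)) 𝓘(ℝ, ℝ) ∞ (fun p : ℝ × M => f p.1 p.2)
  smooth_flow : ContMDiff (𝓘(ℝ, ℝ).prod (𝓡 n)) (𝓡 n) ∞ (fun p : ℝ × M => φ p.1 p.2)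
  init : φ 0 = 1
  deriv : ∀ (g : Smooth n M) (t : ℝ) (x : M),
    HasDerivAt (fun s => g (φ s x)) (P.bracket g (f t) (φ t x)) t

/-- The group of Hamiltonian diffeomorphisms: the group generated by Hamiltonian flows. -/
def hamGroup (P : PoissonBracket n M) : Subgroup (M ≃ₜ M) :=
  Subgroup.closure {ψ | ∃ (f : ℝ → Smooth n M) (φ : ℝ → M ≃ₜ M) (t : ℝ),
    P.IsHamiltonianFlow f φ ∧ ψ = φ t}

end PoissonBracket

variable [MeasurableSpace M]

/-- The linear functional `F_f(ν) = ∫ f dν` on `Dens`. -/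
def linFunctional (f : Smooth n M) (ν : Dens n M) : ℝ := ∫ x, f x ∂ν.measure

/-- The set of all linear functionals `F_f`. -/
def linFunctionals (n : ℕ) (M : Type*) [TopologicalSpace M]
    [ChartedSpace (EuclideanSpace ℝ (Fin n)) M] [MeasurableSpace M] : Set (Dens n M → ℝ) :=
  range (linFunctional (n := n) (M := M))

/-- `F_f` as an element of the set of linear functionals. -/
def toLin (f : Smooth n M) : linFunctionals n M := ⟨linFunctional f, mem_range_self f⟩

/-- The bracket on linear functionals, `{F_f, F_g} = F_{f, g}`; the functions `f`, `g` are
determined by the functionals. -/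
def densBracket (P : PoissonBracket n M) (Φ Ψ : linFunctionals n M) : linFunctionals n M :=
  toLin (P.bracket Φ.2.choose Ψ.2.choose)

/-- `c`, on the time interval `[0, 1]`, is an integral curve in `Dens` of the Hamiltonian vector
fields (with respect to the bracket on `Dens`) of the functionals `F_{f_t}`:
`d/dt F_g(c t) = {F_g, F_{f_t}}(c t)` for all `g`. -/
def IsDensHamiltonianCurve (P : PoissonBracket n M) (f : ℝ → Smooth n M) (c : ℝ → Dens n M) :
    Prop :=
  ContMDiff (𝓘(ℝ, ℝ).prod (𝓡 n)) 𝓘(ℝ, ℝ) ∞ (fun p : ℝ × M => f p.1 p.2) ∧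
    ∀ (g : Smooth n M), ∀ t ∈ Icc (0 : ℝ) 1,
      HasDerivWithinAt (fun s => linFunctional g (c s))
        ((densBracket P (toLin g) (toLin (f t)) : Dens n M → ℝ) (c t)) (Icc 0 1) t

/-- Two densities lie on the same symplectic leaf of the bracket on `Dens`: they are joined by
finitely many arcs of Hamiltonian integral curves. -/
def SameLeaf (P : PoissonBracket n M) : Dens n M → Dens n M → Prop :=
  Relation.EqvGen fun ν ν' => ∃ (f : ℝ → Smooth n M) (c : ℝ → Dens n M),
    IsDensHamiltonianCurve P f c ∧ c 0 = ν ∧ c 1 = ν'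

/-- Two densities lie on the same orbit of the group of Hamiltonian diffeomorphisms of `M`. -/
def SameOrbit (P : PoissonBracket n M) (ν ν' : Dens n M) : Prop :=
  ∃ ψ ∈ P.hamGroup, ν'.measure = ν.measure.map ψ

/-- The functional `C_{h,l}(ν) = ∫ h ∘ l dν` on `Dens`. -/
def casimirFunctional (h : ℝ → ℝ) (l : Smooth n M) (ν : Dens n M) : ℝ :=
  ∫ x, h (l x) ∂ν.measure

/-- The tangent space of `Dens` at `ν`: signed smooth densities `u ν` of total integral zero. -/
def densTangent [CompactSpace M] [BorelSpace M] (ν : Dens n M) : Submodule ℝ (Smooth n M) where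
  carrier := {u | ∫ x, u x ∂ν.measure = 0}
  zero_mem' := by simp
  add_mem' := by
    intro u v hu hv
    have : IsFiniteMeasure ν.measure := ⟨by rw [ν.mass_one]; exact ENNReal.one_lt_top⟩
    have hi : ∀ w : Smooth n M, Integrable (fun x => w x) ν.measure := fun w =>
      w.contMDiff.continuous.integrable_of_hasCompactSupport (HasCompactSupport.of_compactSpace _)
    simp only [mem_ofPred_eq] at hu hv ⊢
    have h := integral_add (hi u) (hi v)
    rw [hu, hv, add_zero] at h
    exact h
  smul_mem' := by
    intro c u hu
    simp only [mem_ofPred_eq] at hu ⊢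
    have h := integral_const_mul (μ := ν.measure) c (fun x => u x)
    rw [hu, mul_zero] at h
    exact h

/-- The functional `Φ` on `Dens` has differential `D` at `ν`: for each tangent vector `u ν`, its
derivative along the curve `(1 + t u) ν` (defined for `t` near `0`) is `D u`. -/
def HasDensDifferential [CompactSpace M] [BorelSpace M] (Φ : Dens n M → ℝ) (ν : Dens n M)
    (D : densTangent ν →ₗ[ℝ] ℝ) : Prop :=
  ∀ u : densTangent ν, ∃ c : ℝ → Dens n M, c 0 = ν ∧
    (∀ᶠ t in 𝓝 (0 : ℝ), (c t).measure =
      ν.measure.withDensity fun x => ENNReal.ofReal (1 + t * (u : Smooth n M) x)) ∧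
    HasDerivAt (fun t => Φ (c t)) (D u) 0

/-- Functional independence: at every point of `Dens` the differentials exist and are linearly
independent. -/
def FunctionallyIndependent [CompactSpace M] [BorelSpace M] {ι : Type*}
    (Φ : ι → Dens n M → ℝ) : Prop :=
  ∀ ν : Dens n M, ∃ D : ι → (densTangent ν →ₗ[ℝ] ℝ),
    (∀ i, HasDensDifferential (Φ i) ν (D i)) ∧ LinearIndependent ℝ D

end

end PoissonDens

end

/-!
The functional `C_{h,l}` depends on a density `ν` only through the distribution of `l`, the measure
`ν.map l` on the line, so invariance of this distribution is the heart of the matter.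

Functions of a Casimir are Casimirs (`PoissonBracket.IsCasimir.comp`): the bracket with a fixed
function is a derivation, and Hadamard's lemma `h s = h c + (s - c) * k s` reduces the chain rule at
a point to the Leibniz rule. Consequently `∫ p(l) dν` is constant along Hamiltonian curves of
densities for every polynomial `p`, and as `l` is bounded these moments determine the distribution
(`SameLeaf.map_eq`). Hamiltonian diffeomorphisms preserve `l` itself (`SameOrbit.map_eq`). For
arbitrary, possibly non-measurable, `h` one needs moreover that measurability of `h ∘ l` up to null
sets passes to `h`; this follows from inner regularity, since continuous images of compact sets are
compact (`aemeasurable_map_of_comp`).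

Densities abound. One is obtained by adding Lebesgue measures in charts, cut off by bump functions
(`exists_isFiniteMeasure_isSmoothDensity`); the change of variables formula gives its density in an
arbitrary chart. Given `ν`, the perturbations `(1 + t u) ν` with `∫ u dν = 0` and `t` small are again
densities. If `F_d` vanishes identically, the choice `u = d` gives `∫ d² dν = 0`, so that `F_f`
determines `f` (`linFunctional_injective`) and the bracket on densities is the expected one; in the
same way a differential `u ↦ ∫ f u dν` vanishes only for constant `f`
(`eq_const_of_tangentFunctional_eq_zero`). Hence a linear relation between the differentials of
`C_{h,l}` for `h = s, s², s³, …` makes a polynomial in `l` without constant term constant; if `l` is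
not locally constant it has infinitely many values, and the relation is trivial
(`functionallyIndependent_pow`).
-/

namespace PoissonDens

/-! ### Hadamard's lemma in one variable -/

/-- Differentiation under the integral sign. -/
theorem hasDerivAt_integral_pow_mul_comp {f : ℝ → ℝ} (hf : ContDiff ℝ 1 f) (c : ℝ) (m : ℕ)
    (s : ℝ) :
    HasDerivAt (fun s => ∫ t in (0 : ℝ)..1, t ^ m * f (c + t * (s - c)))
      (∫ t in (0 : ℝ)..1, t ^ (m + 1) * deriv f (c + t * (s - c))) s := by
  have hf' : Continuous (deriv f) := hf.continuous_deriv le_rfl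
  obtain ⟨B, hB⟩ := ((isCompact_closedBall s 1).prod (isCompact_Icc (a := (0 : ℝ)) (b := 1))
    ).exists_bound_of_continuousOn
    (f := fun p : ℝ × ℝ => p.2 ^ (m + 1) * deriv f (c + p.2 * (p.1 - c)))
    (Continuous.continuousOn (by fun_prop))
  refine (intervalIntegral.hasDerivAt_integral_of_dominated_loc_of_deriv_le
    (F := fun s t => t ^ m * f (c + t * (s - c)))
    (F' := fun s t => t ^ (m + 1) * deriv f (c + t * (s - c))) (bound := fun _ => B)
    (Metric.closedBall_mem_nhds s one_pos) ?_ ?_ ?_ ?_ ?_ ?_).2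
  · exact Eventually.of_forall fun s =>
      (Continuous.aestronglyMeasurable (by have := hf.continuous; fun_prop))
  · exact Continuous.intervalIntegrable (by have := hf.continuous; fun_prop) _ _
  · exact Continuous.aestronglyMeasurable (by fun_prop)
  · refine Eventually.of_forall fun t ht x hx => hB (x, t) ⟨hx, ?_⟩
    rw [uIoc_of_le zero_le_one] at ht
    exact ⟨ht.1.le, ht.2⟩
  · exact intervalIntegrable_const
  · refine Eventually.of_forall fun t _ x _ => ?_
    have h1 : HasDerivAt (fun s => c + t * (s - c)) t x := by
      simpa using (((hasDerivAt_id x).sub_const c).const_mul t).const_add c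
    have h2 := (((hf.differentiable one_ne_zero).differentiableAt.hasDerivAt
      (x := c + t * (x - c))).comp x h1).const_mul (t ^ m)
    refine h2.congr_deriv ?_
    ring

theorem contDiff_integral_pow_mul_comp (N : ℕ) : ∀ {f : ℝ → ℝ}, ContDiff ℝ ∞ f →
    ∀ (c : ℝ) (m : ℕ),
      ContDiff ℝ N (fun s => ∫ t in (0 : ℝ)..1, t ^ m * f (c + t * (s - c))) := by
  induction N with
  | zero =>
    intro f hf c m
    refine contDiff_zero.2 (continuous_iff_continuousAt.2 fun s => ?_)
    exact (hasDerivAt_integral_pow_mul_comp (hf.of_le (by simp)) c m s).continuousAt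
  | succ N ih =>
    intro f hf c m
    have hd := hasDerivAt_integral_pow_mul_comp (hf.of_le (by simp)) c m
    push_cast
    refine contDiff_succ_iff_deriv.2 ⟨fun s => (hd s).differentiableAt, by simp, ?_⟩
    rw [funext fun s => (hd s).deriv]
    exact ih (contDiff_infty_iff_deriv.1 hf).2 c (m + 1)

/-- A smooth function on the line is `h c + (s - c) * k s` with `k` smooth. -/
theorem exists_contDiff_sub_mul {h : ℝ → ℝ} (hh : ContDiff ℝ ∞ h) (c : ℝ) :
    ∃ k : ℝ → ℝ, ContDiff ℝ ∞ k ∧ ∀ s, h s = h c + (s - c) * k s := by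
  have hd := (contDiff_infty_iff_deriv.1 hh).2
  refine ⟨fun s => ∫ t in (0 : ℝ)..1, t ^ 0 * deriv h (c + t * (s - c)),
    contDiff_infty.2 fun N => contDiff_integral_pow_mul_comp N hd c 0, fun s => ?_⟩
  have h1 : ∀ t, HasDerivAt (fun t => h (c + t * (s - c)))
      ((s - c) * (t ^ 0 * deriv h (c + t * (s - c)))) t := by
    intro t
    have h1 : HasDerivAt (fun t => c + t * (s - c)) (s - c) t := by
      simpa using ((hasDerivAt_id t).mul_const (s - c)).const_add c
    refine (((hh.differentiable (by simp)).differentiableAt.hasDerivAt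
      (x := c + t * (s - c))).comp t h1).congr_deriv ?_
    ring
  have h2 := intervalIntegral.integral_eq_sub_of_hasDerivAt (a := 0) (b := 1)
    (fun t _ => h1 t)
    (Continuous.intervalIntegrable (by have := hd.continuous; fun_prop) _ _)
  rw [intervalIntegral.integral_const_mul] at h2
  rw [h2]
  simp

/-! ### Functions of a Casimir -/

section

variable {n : ℕ} {M : Type*} [TopologicalSpace M] [ChartedSpace (EuclideanSpace ℝ (Fin n)) M]

/-- The smooth function `h ∘ l`. -/
noncomputable def compSmooth {h : ℝ → ℝ} (hh : ContDiff ℝ ∞ h) (l : Smooth n M) : Smooth n M :=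
  ⟨fun x => h (l x), hh.contMDiff.comp l.contMDiff⟩

@[simp]
theorem compSmooth_apply {h : ℝ → ℝ} (hh : ContDiff ℝ ∞ h) (l : Smooth n M) (x : M) :
    compSmooth hh l x = h (l x) := rfl

namespace PoissonBracket

variable (P : PoissonBracket n M)

theorem bracket_one (f : Smooth n M) : P.bracket f 1 = 0 := by
  have h := P.leibniz f 1 1
  simpa using h

theorem IsCasimir.bracket_right {P : PoissonBracket n M} {l : Smooth n M} (hl : P.IsCasimir l)
    (f : Smooth n M) : P.bracket f l = 0 := by
  rw [P.skew, hl f, neg_zero]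

/-- If `l` is a Casimir then so is `h ∘ l`: at a point `x`, write `h s = h c + (s - c) * k s` with
`c = l x`, so that by the Leibniz rule `{f, h ∘ l}` is `(l - c) * {f, k ∘ l}`, which vanishes
at `x`. -/
theorem IsCasimir.comp {P : PoissonBracket n M} {l : Smooth n M} (hl : P.IsCasimir l)
    {h : ℝ → ℝ} (hh : ContDiff ℝ ∞ h) : P.IsCasimir (compSmooth hh l) := by
  suffices H : ∀ f, P.bracket f (compSmooth hh l) = 0 by
    intro g
    rw [P.skew, H, neg_zero]
  intro f
  ext x
  obtain ⟨k, hk, hs⟩ := exists_contDiff_sub_mul hh (l x)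
  have e : compSmooth hh l
      = h (l x) • (1 : Smooth n M) + (l - l x • (1 : Smooth n M)) * compSmooth hk l := by
    ext y
    have := hs (l y)
    change h (l y) = h (l x) * 1 + (l y - l x * 1) * k (l y)
    rw [this]; ring
  rw [e, map_add, map_smul, P.bracket_one, P.leibniz, map_sub, map_smul, P.bracket_one,
    hl.bracket_right]
  change h (l x) * 0 + ((0 - l x * 0) * _ + (l x - l x * 1) * _) = 0
  ring

/-- Hamiltonian diffeomorphisms preserve every Casimir. -/
theorem IsCasimir.comp_hamGroup {P : PoissonBracket n M} {l : Smooth n M} (hl : P.IsCasimir l)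
    {ψ : M ≃ₜ M} (hψ : ψ ∈ P.hamGroup) : ∀ x, l (ψ x) = l x := by
  induction hψ using Subgroup.closure_induction with
  | mem ψ hψ =>
    obtain ⟨f, φ, t, hφ, rfl⟩ := hψ
    intro x
    have hd : ∀ s, HasDerivAt (fun s => l (φ s x)) 0 s := fun s => by
      simpa [hl (f s)] using hφ.deriv l s x
    have h := is_const_of_deriv_eq_zero (fun s => (hd s).differentiableAt)
      (fun s => (hd s).deriv) t 0
    simpa [hφ.init] using h
  | one => intro x; rfl
  | mul ψ χ _ _ h1 h2 =>
    intro x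
    exact (h1 (χ x)).trans (h2 x)
  | inv ψ _ h1 =>
    intro x
    have := h1 (ψ⁻¹ x)
    rw [← this]
    congr 1
    exact ψ.apply_symm_apply x

end PoissonBracket

theorem SameOrbit.map_eq [MeasurableSpace M] [BorelSpace M] {P : PoissonBracket n M}
    {l : Smooth n M} (hl : P.IsCasimir l) {ν ν' : Dens n M} (h : SameOrbit P ν ν') :
    ν.measure.map l = ν'.measure.map l := by
  obtain ⟨ψ, hψ, h⟩ := h
  rw [h, Measure.map_map l.contMDiff.continuous.measurable ψ.continuous.measurable]
  exact congrArg (ν.measure.map ·) (funext fun x => (hl.comp_hamGroup hψ x).symm)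

end

/-! ### Pushforward of a measure by a real function -/

section

variable {X : Type*} [TopologicalSpace X] [MeasurableSpace X] [BorelSpace X]

/-- If `l ⁻¹' B` is null-measurable, then `B` is enclosed in a measurable set with the same
preimage up to a null set. Compact subsets exhausting the complement of `l ⁻¹' B` have compact
images, whose union is removed from the line. -/
theorem exists_measurableSet_superset_preimage {ν : Measure X} [IsFiniteMeasure ν]
    [ν.InnerRegularCompactLTTop] {l : X → ℝ} (hl : Continuous l) {B : Set ℝ}
    (hB : NullMeasurableSet (l ⁻¹' B) ν) [T2Space X] :
    ∃ U, B ⊆ U ∧ MeasurableSet U ∧ ν (l ⁻¹' U \ l ⁻¹' B) = 0 := by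
  obtain ⟨A, hA, hAm, hAe⟩ := hB.compl.exists_measurable_subset_ae_eq
  have hK : ∀ k : ℕ, ∃ K ⊆ A, IsCompact K ∧ ν (A \ K) < ((k : ENNReal) + 1)⁻¹ := fun k =>
    hAm.exists_isCompact_sdiff_lt (measure_ne_top _ _) (by simp)
  choose K hKA hKc hKν using hK
  refine ⟨(⋃ k, l '' K k)ᶜ, ?_, ?_, ?_⟩
  · rw [subset_compl_comm]
    exact iUnion_subset fun k => image_subset_iff.2 fun x hx => hA (hKA k hx)
  · exact (MeasurableSet.iUnion fun k => ((hKc k).image hl).measurableSet).compl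
  · have h1 : ν ((l ⁻¹' B)ᶜ \ A) = 0 := (ae_le_set.1 hAe.symm.le)
    have h2 : ν (A \ ⋃ k, K k) = 0 := by
      refine le_antisymm (ge_of_tendsto' (x := atTop) (f := fun k : ℕ => ((k : ENNReal) + 1)⁻¹)
        ?_ fun k => ?_) zero_le
      · have := (tendsto_add_atTop_iff_nat 1).2 ENNReal.tendsto_inv_nat_nhds_zero
        exact_mod_cast this
      · exact (measure_mono (sdiff_subset_sdiff_right (subset_iUnion K k))).trans (hKν k).le
    refine measure_mono_null (fun x hx => ?_) (measure_union_null h1 h2)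
    by_cases hxA : x ∈ A
    · refine Or.inr ⟨hxA, fun hxK => ?_⟩
      obtain ⟨k, hk⟩ := mem_iUnion.1 hxK
      exact hx.1 (mem_iUnion.2 ⟨k, mem_image_of_mem l hk⟩)
    · exact Or.inl ⟨hx.2, hxA⟩

/-- Almost everywhere measurability of `h ∘ l` descends to `h`, with no assumption on `h`. -/
theorem aemeasurable_map_of_comp {ν : Measure X} [IsFiniteMeasure ν] [T2Space X]
    [ν.InnerRegularCompactLTTop] {l : X → ℝ} (hl : Continuous l) {h : ℝ → ℝ}
    (hh : AEMeasurable (fun x => h (l x)) ν) : AEMeasurable h (ν.map l) := by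
  -- the criterion for almost everywhere measurability needs values in a complete linear order
  suffices H : AEMeasurable (fun s => (h s : EReal)) (ν.map l) from
    measurable_ereal_toReal.comp_aemeasurable H
  have hh' : AEMeasurable (fun x => (h (l x) : EReal)) ν :=
    measurable_coe_real_ereal.comp_aemeasurable hh
  obtain ⟨S, hSc, hSd⟩ := TopologicalSpace.exists_countable_dense EReal
  refine aemeasurable_of_exist_almost_disjoint_supersets _ S hSc hSd _ fun p _ q _ hpq => ?_
  obtain ⟨U, hU, hUm, hUν⟩ := exists_measurableSet_superset_preimage hl
    (B := {s | (h s : EReal) < p}) (hh'.nullMeasurable measurableSet_Iio)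
  obtain ⟨V, hV, hVm, hVν⟩ := exists_measurableSet_superset_preimage hl
    (B := {s | q < (h s : EReal)}) (hh'.nullMeasurable measurableSet_Ioi)
  refine ⟨U, V, hUm, hVm, hU, hV, ?_⟩
  rw [Measure.map_apply hl.measurable (hUm.inter hVm)]
  refine measure_mono_null (fun x hx => ?_) (measure_union_null hUν hVν)
  by_cases hp : (h (l x) : EReal) < p
  · exact Or.inr ⟨hx.2, fun hq => lt_asymm (hp.trans hpq) hq⟩
  · exact Or.inl ⟨hx.1, hp⟩

theorem integrable_comp_iff_map {ν : Measure X} [IsFiniteMeasure ν] [T2Space X]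
    [ν.InnerRegularCompactLTTop] {l : X → ℝ} (hl : Continuous l) (h : ℝ → ℝ) :
    Integrable (fun x => h (l x)) ν ↔ Integrable h (ν.map l) := by
  constructor
  · intro hi
    exact (integrable_map_measure (aemeasurable_map_of_comp hl
      hi.aestronglyMeasurable.aemeasurable).aestronglyMeasurable hl.aemeasurable).2 hi
  · intro hi
    exact (integrable_map_measure hi.aestronglyMeasurable hl.aemeasurable).1 hi

theorem integral_comp_eq_map {ν : Measure X} [IsFiniteMeasure ν] [T2Space X]
    [ν.InnerRegularCompactLTTop] {l : X → ℝ} (hl : Continuous l) (h : ℝ → ℝ) :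
    ∫ x, h (l x) ∂ν = ∫ s, h s ∂(ν.map l) := by
  by_cases hi : Integrable h (ν.map l)
  · exact (integral_map hl.aemeasurable hi.aestronglyMeasurable).symm
  · rw [integral_undef hi, integral_undef (mt (integrable_comp_iff_map hl h).1 hi)]

theorem integrable_of_continuous [CompactSpace X] {ν : Measure X} [IsFiniteMeasure ν] {f : X → ℝ}
    (hf : Continuous f) : Integrable f ν :=
  hf.integrable_of_hasCompactSupport (HasCompactSupport.of_compactSpace _)

/-- Polynomial moments of a bounded function determine its distribution, by Weierstrass
approximation. -/
theorem map_eq_of_forall_integral_polynomial_eq [CompactSpace X] {ν ν' : Measure X}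
    [IsProbabilityMeasure ν] [IsProbabilityMeasure ν'] {l : X → ℝ} (hl : Continuous l)
    (H : ∀ p : Polynomial ℝ, ∫ x, p.eval (l x) ∂ν = ∫ x, p.eval (l x) ∂ν') :
    ν.map l = ν'.map l := by
  have := Measure.isFiniteMeasure_map ν l
  have := Measure.isFiniteMeasure_map ν' l
  refine ext_of_forall_integral_eq_of_IsFiniteMeasure fun f => ?_
  have hf := f.continuous
  rw [integral_map hl.aemeasurable hf.aestronglyMeasurable,
    integral_map hl.aemeasurable hf.aestronglyMeasurable]
  obtain ⟨R, hR⟩ := (isCompact_univ (X := X)).exists_bound_of_continuousOn hl.continuousOn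
  have key : ∀ ε > 0, ∀ p : Polynomial ℝ, (∀ x ∈ Icc (-R) R, |p.eval x - f x| < ε) →
      ∀ (m : Measure X) [IsProbabilityMeasure m],
      |∫ x, p.eval (l x) ∂m - ∫ x, f (l x) ∂m| ≤ ε := by
    intro ε _ p hp m _
    rw [← integral_sub (integrable_of_continuous (by fun_prop))
      (integrable_of_continuous (by fun_prop))]
    have h : ∀ x, ‖p.eval (l x) - f (l x)‖ ≤ ε := fun x =>
      (hp (l x) (abs_le.1 (hR x (mem_univ x)))).le
    simpa using norm_integral_le_of_norm_le_const (μ := m) (Eventually.of_forall h)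
  refine eq_of_forall_dist_le fun ε hε => ?_
  obtain ⟨p, hp⟩ := exists_polynomial_near_of_continuousOn (-R) R f hf.continuousOn (ε / 2)
    (half_pos hε)
  have h1 := key _ (half_pos hε) p hp ν
  have h2 := key _ (half_pos hε) p hp ν'
  rw [H p] at h1
  rw [Real.dist_eq]
  rw [abs_le] at *
  constructor <;> linarith [h1.1, h1.2, h2.1, h2.2]

end

/-! ### Measures with a smooth positive density in every chart -/

theorem contDiffOn_comp_chart_symm {n : ℕ} {M : Type*} [TopologicalSpace M]
    [ChartedSpace (EuclideanSpace ℝ (Fin n)) M]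
    {e : OpenPartialHomeomorph M (EuclideanSpace ℝ (Fin n))}
    (he : e ∈ IsManifold.maximalAtlas (𝓡 n) ∞ M) {f : M → ℝ}
    (hf : ContMDiff (𝓡 n) 𝓘(ℝ, ℝ) ∞ f) : ContDiffOn ℝ ∞ (fun y => f (e.symm y)) e.target :=
  contMDiffOn_iff_contDiffOn.1 (hf.comp_contMDiffOn (contMDiffOn_symm_of_mem_maximalAtlas he))

section

variable {n : ℕ} {M : Type*} [TopologicalSpace M] [MeasurableSpace M]

/-- The image under the inverse chart `e.symm` of the measure with density `ρ` on `e.target`. -/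
noncomputable def chartMeasure (e : OpenPartialHomeomorph M (EuclideanSpace ℝ (Fin n)))
    (ρ : EuclideanSpace ℝ (Fin n) → ℝ) : Measure M :=
  ((volume.restrict e.target).withDensity fun y => ENNReal.ofReal (ρ y)).map e.symm

variable [BorelSpace M] (e : OpenPartialHomeomorph M (EuclideanSpace ℝ (Fin n)))

theorem aemeasurable_chart_symm : AEMeasurable e.symm (volume.restrict e.target) :=
  e.continuousOn_symm.aemeasurable e.open_target.measurableSet

theorem measurableSet_chart_image {s : Set M} (hs : s ⊆ e.source) (hm : MeasurableSet s) :
    MeasurableSet (e '' s) := by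
  have h1 : Measurable (e.target.domRestrict e.symm) :=
    (continuousOn_iff_continuous_domRestrict.1 e.continuousOn_symm).measurable
  have h2 := MeasurableSet.subtype_image e.open_target.measurableSet (h1 hm)
  convert h2 using 1
  rw [e.image_eq_target_inter_inv_preimage hs]
  ext y
  simp [Set.domRestrict, and_comm]

theorem chartMeasure_apply (ρ : EuclideanSpace ℝ (Fin n) → ℝ) {s : Set M}
    (hm : MeasurableSet s) :
    chartMeasure e ρ s = ∫⁻ y in e.target ∩ e.symm ⁻¹' s, ENNReal.ofReal (ρ y) := by
  have h := aemeasurable_chart_symm e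
  rw [chartMeasure, Measure.map_apply_of_aemeasurable
    (h.mono_ac (withDensity_absolutelyContinuous _ _)) hm, withDensity_apply',
    Measure.restrict_restrict₀ (h.nullMeasurable hm), inter_comm]

theorem lintegral_chartMeasure {ρ : EuclideanSpace ℝ (Fin n) → ℝ}
    (hρ : ContinuousOn ρ e.target) {f : M → ENNReal} (hf : Measurable f) :
    ∫⁻ x, f x ∂(chartMeasure e ρ)
      = ∫⁻ y in e.target, ENNReal.ofReal (ρ y) * f (e.symm y) := by
  have h := aemeasurable_chart_symm e
  have hρ' : AEMeasurable (fun y => ENNReal.ofReal (ρ y)) (volume.restrict e.target) :=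
    (hρ.aemeasurable e.open_target.measurableSet).ennreal_ofReal
  rw [chartMeasure, lintegral_map' hf.aemeasurable
    (h.mono_ac (withDensity_absolutelyContinuous _ _)),
    show (fun y => f (e.symm y)) = f ∘ e.symm from rfl,
    lintegral_withDensity_eq_lintegral_mul₀ hρ' (hf.comp_aemeasurable h)]
  rfl

theorem restrict_source_eq_chartMeasure {μ : Measure M} {ρ : EuclideanSpace ℝ (Fin n) → ℝ}
    (H : ∀ s ⊆ e.source, MeasurableSet s → μ s = ∫⁻ y in e '' s, ENNReal.ofReal (ρ y)) :
    μ.restrict e.source = chartMeasure e ρ := by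
  ext s hs
  rw [Measure.restrict_apply hs, chartMeasure_apply e ρ hs,
    H _ inter_subset_right (hs.inter e.open_source.measurableSet), inter_comm,
    e.image_source_inter_eq']

theorem withDensity_chart_apply {μ : Measure M} {ρ : EuclideanSpace ℝ (Fin n) → ℝ}
    (hρ : ContinuousOn ρ e.target) (hρ0 : ∀ y ∈ e.target, 0 < ρ y)
    (H : ∀ s ⊆ e.source, MeasurableSet s → μ s = ∫⁻ y in e '' s, ENNReal.ofReal (ρ y))
    {f : M → ℝ} (hf : Measurable f) {s : Set M} (hs : s ⊆ e.source) (hm : MeasurableSet s) :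
    μ.withDensity (fun x => ENNReal.ofReal (f x)) s
      = ∫⁻ y in e '' s, ENNReal.ofReal (ρ y * f (e.symm y)) := by
  have hf' := hf.ennreal_ofReal
  have himg := measurableSet_chart_image e hs hm
  have hsub : e '' s ⊆ e.target := by
    rw [e.image_eq_target_inter_inv_preimage hs]; exact inter_subset_left
  rw [withDensity_apply _ hm, ← inter_eq_left.2 hs, ← Measure.restrict_restrict hm,
    restrict_source_eq_chartMeasure e H, ← lintegral_indicator hm,
    lintegral_chartMeasure e hρ (hf'.indicator hm), inter_eq_left.2 hs,
    ← inter_eq_left.2 hsub, ← Measure.restrict_restrict himg, ← lintegral_indicator himg]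
  refine setLIntegral_congr_fun e.open_target.measurableSet fun y hy => ?_
  by_cases hys : e.symm y ∈ s
  · have : y ∈ e '' s := ⟨_, hys, e.right_inv hy⟩
    simp only [indicator_of_mem hys, indicator_of_mem this]
    rw [ENNReal.ofReal_mul (hρ0 y hy).le]
  · have : y ∉ e '' s := by
      rintro ⟨x, hx, rfl⟩
      exact hys (by rwa [e.left_inv (hs hx)])
    simp only [indicator_of_notMem hys, indicator_of_notMem this, mul_zero]

theorem chartMeasure_univ_lt_top {w : M → ℝ} (hw : Continuous w) (hc : HasCompactSupport w)
    (hws : tsupport w ⊆ e.source) : chartMeasure e (fun z => w (e.symm z)) univ < ⊤ := by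
  obtain ⟨B, hB⟩ := hw.bounded_above_of_compact_support hc
  have hK : IsCompact (e '' tsupport w) :=
    hc.isCompact.image_of_continuousOn (e.continuousOn.mono hws)
  rw [chartMeasure_apply e _ MeasurableSet.univ]
  calc _ ≤ ∫⁻ z in e.target, (e '' tsupport w).indicator (fun _ => ENNReal.ofReal B) z := by
        rw [preimage_univ, inter_univ]
        refine setLIntegral_mono' e.open_target.measurableSet fun z hz => ?_
        by_cases h : e.symm z ∈ tsupport w
        · have hz' : z ∈ e '' tsupport w := ⟨_, h, e.right_inv hz⟩
          rw [indicator_of_mem hz']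
          exact ENNReal.ofReal_le_ofReal ((le_abs_self _).trans (hB _))
        · rw [image_eq_zero_of_notMem_tsupport h]
          simp
    _ ≤ ∫⁻ z, (e '' tsupport w).indicator (fun _ => ENNReal.ofReal B) z :=
        setLIntegral_le_lintegral _ _
    _ = ENNReal.ofReal B * volume (e '' tsupport w) := lintegral_indicator_const hK.measurableSet _
    _ < ⊤ := ENNReal.mul_lt_top ENNReal.ofReal_lt_top hK.measure_lt_top

end

section

/-- In every chart, `μ` has a smooth positive density with respect to Lebesgue measure. -/
def IsSmoothDensity (n : ℕ) {M : Type*} [TopologicalSpace M]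
    [ChartedSpace (EuclideanSpace ℝ (Fin n)) M] [MeasurableSpace M] (μ : Measure M) : Prop :=
  ∀ e ∈ IsManifold.maximalAtlas (𝓡 n) ∞ M,
    ∃ ρ : EuclideanSpace ℝ (Fin n) → ℝ, ContDiffOn ℝ ∞ ρ e.target ∧
      (∀ y ∈ e.target, 0 < ρ y) ∧
      ∀ s ⊆ e.source, MeasurableSet s → μ s = ∫⁻ y in e '' s, ENNReal.ofReal (ρ y)

variable {n : ℕ} {M : Type*} [TopologicalSpace M] [ChartedSpace (EuclideanSpace ℝ (Fin n)) M]
  [MeasurableSpace M] [BorelSpace M]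

theorem IsSmoothDensity.withDensity {μ : Measure M} (hμ : IsSmoothDensity n μ) {f : M → ℝ}
    (hf : ContMDiff (𝓡 n) 𝓘(ℝ, ℝ) ∞ f) (hf0 : ∀ x, 0 < f x) :
    IsSmoothDensity n (μ.withDensity fun x => ENNReal.ofReal (f x)) := by
  intro e he
  obtain ⟨ρ, hρ, hρ0, H⟩ := hμ e he
  exact ⟨fun y => ρ y * f (e.symm y), hρ.mul (contDiffOn_comp_chart_symm he hf),
    fun y hy => mul_pos (hρ0 y hy) (hf0 _),
    fun s hs hm => withDensity_chart_apply e hρ.continuousOn hρ0 H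
      hf.continuous.measurable hs hm⟩

theorem IsSmoothDensity.isOpenPosMeasure [IsManifold (𝓡 n) ∞ M] {μ : Measure M}
    (hμ : IsSmoothDensity n μ) : μ.IsOpenPosMeasure := by
  refine ⟨fun U hU ⟨x, hx⟩ h0 => ?_⟩
  have he := IsManifold.chart_mem_maximalAtlas (I := 𝓡 n) (n := ∞) x
  set e := chartAt (EuclideanSpace ℝ (Fin n)) x
  obtain ⟨ρ, hρ, hρ0, H⟩ := hμ e he
  have hV : IsOpen (U ∩ e.source) := hU.inter e.open_source
  have hV' : IsOpen (e '' (U ∩ e.source)) :=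
    e.isOpen_image_of_subset_source hV inter_subset_right
  have h1 := H _ inter_subset_right hV.measurableSet
  have hsub : e '' (U ∩ e.source) ⊆ e.target := by
    rw [e.image_eq_target_inter_inv_preimage inter_subset_right]; exact inter_subset_left
  rw [measure_mono_null inter_subset_left h0, eq_comm, setLIntegral_eq_zero_iff'
    hV'.measurableSet ((hρ.mono hsub).continuousOn.aemeasurable hV'.measurableSet).ennreal_ofReal]
    at h1
  refine (hV'.measure_pos volume ⟨e x, mem_image_of_mem e ⟨hx, mem_chart_source _ x⟩⟩).ne'
    (measure_eq_zero_iff_ae_notMem.2 ?_)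
  filter_upwards [h1] with y hy h
  exact (hρ0 y (hsub h)).not_ge (ENNReal.ofReal_eq_zero.1 (hy h))

end

/-! ### Existence of a smooth positive density -/

theorem contDiff_det (n : ℕ) :
    ContDiff ℝ ∞ fun A : EuclideanSpace ℝ (Fin n) →L[ℝ] EuclideanSpace ℝ (Fin n) => A.det := by
  let b := (EuclideanSpace.basisFun (Fin n) ℝ).toBasis
  have h : ∀ A : EuclideanSpace ℝ (Fin n) →L[ℝ] EuclideanSpace ℝ (Fin n),
      A.det = ∑ σ : Equiv.Perm (Fin n), (Equiv.Perm.sign σ : ℤ) * ∏ i, (A (b i)) (σ i) := by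
    intro A
    rw [ContinuousLinearMap.det, ← LinearMap.det_toMatrix b, Matrix.det_apply']
    refine Finset.sum_congr rfl fun σ _ => ?_
    congr 1
    exact Finset.prod_congr rfl fun i _ => LinearMap.toMatrix_apply b b _ _ _
  rw [funext h]
  refine ContDiff.sum fun σ _ => contDiff_const.mul (contDiff_prod fun i _ => ?_)
  have h1 : ContDiff ℝ ∞ fun A : EuclideanSpace ℝ (Fin n) →L[ℝ] EuclideanSpace ℝ (Fin n) =>
      A (b i) := contDiff_id.clm_apply contDiff_const
  exact (EuclideanSpace.proj (𝕜 := ℝ) (σ i)).contDiff.comp h1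

section

variable {n : ℕ} {M : Type*} [TopologicalSpace M] [ChartedSpace (EuclideanSpace ℝ (Fin n)) M]
  {e e' : OpenPartialHomeomorph M (EuclideanSpace ℝ (Fin n))}

/-- The absolute value of the Jacobian determinant of the transition map from the chart `e` to the
chart `e'`. -/
noncomputable def jacobian (e e' : OpenPartialHomeomorph M (EuclideanSpace ℝ (Fin n)))
    (y : EuclideanSpace ℝ (Fin n)) : ℝ :=
  |(fderiv ℝ (fun y => e' (e.symm y)) y).det|

theorem contDiffAt_transition (he : e ∈ IsManifold.maximalAtlas (𝓡 n) ∞ M)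
    (he' : e' ∈ IsManifold.maximalAtlas (𝓡 n) ∞ M) {y : EuclideanSpace ℝ (Fin n)}
    (hy : y ∈ e.target) (hy' : e.symm y ∈ e'.source) :
    ContDiffAt ℝ ∞ (fun y => e' (e.symm y)) y := by
  refine contMDiffAt_iff_contDiffAt.1 (ContMDiffAt.comp y
    ((contMDiffOn_of_mem_maximalAtlas he').contMDiffAt (e'.open_source.mem_nhds hy'))
    ((contMDiffOn_symm_of_mem_maximalAtlas he).contMDiffAt (e.open_target.mem_nhds hy)))

theorem det_fderiv_transition_ne_zero (he : e ∈ IsManifold.maximalAtlas (𝓡 n) ∞ M)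
    (he' : e' ∈ IsManifold.maximalAtlas (𝓡 n) ∞ M) {y : EuclideanSpace ℝ (Fin n)}
    (hy : y ∈ e.target) (hy' : e.symm y ∈ e'.source) :
    (fderiv ℝ (fun y => e' (e.symm y)) y).det ≠ 0 := by
  have h1 := ((contDiffAt_transition he he' hy hy').differentiableAt (by simp)).hasFDerivAt
  have h2 := ((contDiffAt_transition he' he (y := e' (e.symm y)) (e'.map_source hy')
    (by rw [e'.left_inv hy']; exact e.map_target hy)).differentiableAt (by simp)).hasFDerivAt
  -- the transition maps in the two directions are inverse to each other near `y`
  have h3 := h2.comp y h1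
  have h4 : (fun z => e (e'.symm z)) ∘ (fun y => e' (e.symm y)) =ᶠ[𝓝 y] id := by
    filter_upwards [(e.isOpen_inter_preimage_symm e'.open_source).mem_nhds ⟨hy, hy'⟩] with z hz
    simp only [Function.comp_apply, id_eq]
    rw [e'.left_inv hz.2, e.right_inv hz.1]
  have h5 := (h3.congr_of_eventuallyEq h4.symm).unique (hasFDerivAt_id y)
  intro h0
  have h6 := congrArg (fun A : EuclideanSpace ℝ (Fin n) →L[ℝ] EuclideanSpace ℝ (Fin n) => A.det) h5
  simp only [ContinuousLinearMap.det, ContinuousLinearMap.coe_id,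
    LinearMap.det_id] at h6 h0
  rw [ContinuousLinearMap.toLinearMap_comp, LinearMap.det_comp, h0, mul_zero] at h6
  exact zero_ne_one h6

theorem jacobian_pos (he : e ∈ IsManifold.maximalAtlas (𝓡 n) ∞ M)
    (he' : e' ∈ IsManifold.maximalAtlas (𝓡 n) ∞ M) {y : EuclideanSpace ℝ (Fin n)}
    (hy : y ∈ e.target) (hy' : e.symm y ∈ e'.source) : 0 < jacobian e e' y :=
  abs_pos.2 (det_fderiv_transition_ne_zero he he' hy hy')

theorem contDiffAt_jacobian (he : e ∈ IsManifold.maximalAtlas (𝓡 n) ∞ M)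
    (he' : e' ∈ IsManifold.maximalAtlas (𝓡 n) ∞ M) {y : EuclideanSpace ℝ (Fin n)}
    (hy : y ∈ e.target) (hy' : e.symm y ∈ e'.source) : ContDiffAt ℝ ∞ (jacobian e e') y :=
  (contDiffAt_abs (det_fderiv_transition_ne_zero he he' hy hy')).comp y
    ((contDiff_det n).contDiffAt.comp y
      ((contDiffAt_transition he he' hy hy').fderiv_right (by simp)))

/-- A smooth weight supported in the source of `e'`, times the Jacobian of the transition from `e`
to `e'`, is smooth on the whole target of `e`: away from the support it vanishes. -/
theorem contDiffOn_weight_mul_jacobian (he : e ∈ IsManifold.maximalAtlas (𝓡 n) ∞ M)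
    (he' : e' ∈ IsManifold.maximalAtlas (𝓡 n) ∞ M) {w : M → ℝ}
    (hw : ContMDiff (𝓡 n) 𝓘(ℝ, ℝ) ∞ w) (hws : tsupport w ⊆ e'.source) :
    ContDiffOn ℝ ∞ (fun y => w (e.symm y) * jacobian e e' y) e.target := by
  intro y hy
  refine ContDiffAt.contDiffWithinAt ?_
  by_cases hy' : e.symm y ∈ tsupport w
  · exact ((contDiffOn_comp_chart_symm he hw).contDiffAt (e.open_target.mem_nhds hy)).mul
      (contDiffAt_jacobian he he' hy (hws hy'))
  · refine contDiffAt_const (c := (0 : ℝ)) |>.congr_of_eventuallyEq ?_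
    filter_upwards [(e.isOpen_inter_preimage_symm (isClosed_tsupport w).isOpen_compl).mem_nhds
      ⟨hy, hy'⟩] with z hz
    rw [image_eq_zero_of_notMem_tsupport hz.2, zero_mul]

variable [MeasurableSpace M] [BorelSpace M]

/-- Change of variables from the chart `e'` to the chart `e`. -/
theorem chartMeasure_apply_of_subset_source (he : e ∈ IsManifold.maximalAtlas (𝓡 n) ∞ M)
    (he' : e' ∈ IsManifold.maximalAtlas (𝓡 n) ∞ M) {w : M → ℝ}
    (hws : tsupport w ⊆ e'.source) {s : Set M} (hs : s ⊆ e.source) (hm : MeasurableSet s) :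
    chartMeasure e' (fun z => w (e'.symm z)) s
      = ∫⁻ y in e '' s, ENNReal.ofReal (w (e.symm y) * jacobian e e' y) := by
  have hA : s ∩ e'.source ⊆ e.source := inter_subset_left.trans hs
  have hAm := measurableSet_chart_image e hA (hm.inter e'.open_source.measurableSet)
  have hAt : ∀ y ∈ e '' (s ∩ e'.source), y ∈ e.target ∧ e.symm y ∈ e'.source := by
    rintro _ ⟨x, hx, rfl⟩
    exact ⟨e.map_source (hA hx), by rw [e.left_inv (hA hx)]; exact hx.2⟩
  have himg : e'.target ∩ e'.symm ⁻¹' s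
      = (fun y => e' (e.symm y)) '' (e '' (s ∩ e'.source)) := by
    rw [image_image, inter_comm s, ← e'.image_source_inter_eq']
    refine image_congr fun x hx => ?_
    rw [e.left_inv (hs hx.2)]
  have hinj : InjOn (fun y => e' (e.symm y)) (e '' (s ∩ e'.source)) := by
    intro y hy z hz h
    have h' := e'.injOn (hAt y hy).2 (hAt z hz).2 h
    exact e.symm.injOn (hAt y hy).1 (hAt z hz).1 h'
  rw [chartMeasure_apply e' _ hm, himg, lintegral_image_eq_lintegral_abs_det_fderiv_mul volume hAm
    (fun y hy => ((contDiffAt_transition he he' (hAt y hy).1 (hAt y hy).2).differentiableAt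
      (by simp)).hasFDerivAt.hasFDerivWithinAt) hinj,
    ← lintegral_inter_add_sdiff (fun y => ENNReal.ofReal (w (e.symm y) * jacobian e e' y)) (e '' s)
      hAm, inter_eq_right.2 (image_mono inter_subset_left)]
  -- outside the domain of `e'` the right-hand integrand vanishes with the weight
  have hzero : ∫⁻ y in e '' s \ e '' (s ∩ e'.source),
      ENNReal.ofReal (w (e.symm y) * jacobian e e' y) = 0 := by
    refine setLIntegral_eq_zero ((measurableSet_chart_image e hs hm).diff hAm) ?_
    rintro _ ⟨⟨x, hx, rfl⟩, hn⟩
    have hx' : x ∉ e'.source := fun h => hn ⟨x, ⟨hx, h⟩, rfl⟩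
    simp only [Pi.zero_apply]
    rw [e.left_inv (hs hx), image_eq_zero_of_notMem_tsupport (fun h => hx' (hws h)), zero_mul,
      ENNReal.ofReal_zero]
  rw [hzero, add_zero]
  refine setLIntegral_congr_fun hAm fun y hy => ?_
  simp only [jacobian]
  rw [e'.left_inv (hAt y hy).2, mul_comm (w _), ENNReal.ofReal_mul (abs_nonneg _)]

variable [T2Space M] [CompactSpace M] [IsManifold (𝓡 n) ∞ M]

variable (n M) in
/-- Lebesgue measures of finitely many charts, cut off by bump functions that cover the manifold,
add up to a smooth positive density. -/
theorem exists_isFiniteMeasure_isSmoothDensity :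
    ∃ μ : Measure M, IsFiniteMeasure μ ∧ IsSmoothDensity n μ := by
  obtain ⟨ι, fs, hfs⟩ := SmoothBumpCovering.exists_isSubordinate (𝓡 n) (M := M) (s := univ)
    isClosed_univ (U := fun _ => univ) (fun x _ => univ_mem)
  have := fs.fintype
  have hsupp : ∀ i, tsupport (fs i) ⊆ (chartAt (EuclideanSpace ℝ (Fin n)) (fs.c i)).source :=
    fun i => (fs i).tsupport_subset_chartAt_source
  have hatlas := fun i => IsManifold.chart_mem_maximalAtlas (I := 𝓡 n) (n := ∞) (fs.c i)
  refine ⟨∑ i, chartMeasure (chartAt (EuclideanSpace ℝ (Fin n)) (fs.c i))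
    (fun z => fs i ((chartAt (EuclideanSpace ℝ (Fin n)) (fs.c i)).symm z)), ⟨?_⟩, ?_⟩
  · rw [Measure.finsetSum_apply]
    exact ENNReal.sum_lt_top.2 fun i _ =>
      chartMeasure_univ_lt_top _ (fs i).continuous (fs i).hasCompactSupport (hsupp i)
  intro e he
  have hsm := fun i => contDiffOn_weight_mul_jacobian he (hatlas i) (fs i).contMDiff (hsupp i)
  have hnn : ∀ i, ∀ y, 0 ≤ fs i (e.symm y) *
      jacobian e (chartAt (EuclideanSpace ℝ (Fin n)) (fs.c i)) y :=
    fun i y => mul_nonneg (fs i).nonneg (abs_nonneg _)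
  refine ⟨fun y => ∑ i, fs i (e.symm y) *
      jacobian e (chartAt (EuclideanSpace ℝ (Fin n)) (fs.c i)) y,
    ContDiffOn.sum fun i _ => hsm i, fun y hy => ?_, fun s hs hm => ?_⟩
  · -- some bump function equals `1` at the point with coordinates `y`
    refine Finset.sum_pos' (fun i _ => hnn i y)
      ⟨fs.ind (e.symm y) (mem_univ _), Finset.mem_univ _, ?_⟩
    refine mul_pos (by rw [fs.apply_ind]; exact one_pos) ?_
    exact jacobian_pos he (hatlas _) hy (fs.mem_chartAt_ind_source _ _)
  · have himg := measurableSet_chart_image e hs hm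
    have hsub : e '' s ⊆ e.target := by
      rw [e.image_eq_target_inter_inv_preimage hs]; exact inter_subset_left
    simp_rw [ENNReal.ofReal_sum_of_nonneg fun i (_ : i ∈ Finset.univ) => hnn i _]
    rw [lintegral_finsetSum' _ fun i _ =>
      (((hsm i).continuousOn.mono hsub).aemeasurable himg).ennreal_ofReal,
      Measure.finsetSum_apply]
    exact Finset.sum_congr rfl fun i _ =>
      chartMeasure_apply_of_subset_source he (hatlas i) (hsupp i) hs hm

end

/-! ### Linear perturbations of densities -/

theorem contDiff_polynomial_eval (p : Polynomial ℝ) : ContDiff ℝ ∞ fun s => p.eval s := by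
  simpa [Polynomial.coe_aeval_eq_eval] using p.contDiff_aeval (𝕜 := ℝ) ∞

theorem eventually_forall_one_add_mul_pos {n : ℕ} {M : Type*} [TopologicalSpace M]
    [ChartedSpace (EuclideanSpace ℝ (Fin n)) M] [CompactSpace M] (u : Smooth n M) :
    ∀ᶠ t in 𝓝 (0 : ℝ), ∀ x, 0 < 1 + t * u x := by
  obtain ⟨B, hB⟩ := (isCompact_univ (X := M)).exists_bound_of_continuousOn
    (f := u) u.contMDiff.continuous.continuousOn
  have h : ∀ᶠ t in 𝓝 (0 : ℝ), |t| * |B| < 1 := by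
    have : Tendsto (fun t : ℝ => |t| * |B|) (𝓝 0) (𝓝 (|0| * |B|)) :=
      (continuous_abs.mul continuous_const).tendsto 0
    rw [abs_zero, zero_mul] at this
    exact this.eventually_lt_const one_pos
  filter_upwards [h] with t ht x
  have h1 : |t * u x| ≤ |t| * |B| := by
    rw [abs_mul]
    exact mul_le_mul_of_nonneg_left ((hB x (mem_univ x)).trans (le_abs_self B)) (abs_nonneg t)
  linarith [(abs_le.1 (h1.trans ht.le)).1, neg_abs_le (t * u x)]

section

variable {n : ℕ} {M : Type*} [TopologicalSpace M] [ChartedSpace (EuclideanSpace ℝ (Fin n)) M]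
  [MeasurableSpace M]

instance (ν : Dens n M) : IsProbabilityMeasure ν.measure := ⟨ν.mass_one⟩

theorem Dens.isSmoothDensity (ν : Dens n M) : IsSmoothDensity n ν.measure := ν.smooth_pos

variable [BorelSpace M] [CompactSpace M]

theorem Smooth.integrable (f : Smooth n M) (ν : Dens n M) : Integrable (fun x => f x) ν.measure :=
  integrable_of_continuous f.contMDiff.continuous

/-- The density `(1 + u) ν`. -/
noncomputable def Dens.perturb (ν : Dens n M) (u : Smooth n M)
    (hu : ∫ x, u x ∂ν.measure = 0) (hpos : ∀ x, 0 < 1 + u x) : Dens n M where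
  measure := ν.measure.withDensity fun x => ENNReal.ofReal (1 + u x)
  smooth_pos := ν.isSmoothDensity.withDensity (contMDiff_const.add u.contMDiff) hpos
  mass_one := by
    have hi : Integrable (fun x => 1 + u x) ν.measure :=
      (integrable_const _).add (u.integrable ν)
    rw [withDensity_apply _ MeasurableSet.univ, Measure.restrict_univ,
      ← ofReal_integral_eq_lintegral_ofReal hi (Eventually.of_forall fun x => (hpos x).le),
      integral_add (integrable_const _) (u.integrable ν), hu]
    simp

open Classical in
/-- The curve `(1 + t u) ν`, continued by the constant `ν` where this is not a positive density. -/
noncomputable def Dens.curve (ν : Dens n M) (u : densTangent ν) (t : ℝ) : Dens n M :=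
  if h : ∀ x, 0 < 1 + t * (u : Smooth n M) x then
    ν.perturb (t • u : densTangent ν) (t • u : densTangent ν).2 h
  else ν

theorem Dens.curve_measure (ν : Dens n M) (u : densTangent ν) {t : ℝ}
    (h : ∀ x, 0 < 1 + t * (u : Smooth n M) x) : (ν.curve u t).measure =
      ν.measure.withDensity fun x => ENNReal.ofReal (1 + t * (u : Smooth n M) x) := by
  rw [Dens.curve, dif_pos h]
  rfl

theorem Dens.curve_zero (ν : Dens n M) (u : densTangent ν) : ν.curve u 0 = ν := by
  refine Dens.ext ?_
  rw [ν.curve_measure u (by simp)]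
  simp

theorem Dens.integral_curve (ν : Dens n M) (u : densTangent ν) {f : M → ℝ} (hf : Continuous f) :
    ∀ᶠ t in 𝓝 (0 : ℝ), ∫ x, f x ∂(ν.curve u t).measure
      = ∫ x, f x ∂ν.measure + t * ∫ x, f x * (u : Smooth n M) x ∂ν.measure := by
  filter_upwards [eventually_forall_one_add_mul_pos (u : Smooth n M)] with t ht
  have hu := (u : Smooth n M).contMDiff.continuous
  rw [ν.curve_measure u ht, integral_withDensity_eq_integral_toReal_smul
    (by fun_prop) (Eventually.of_forall fun x => ENNReal.ofReal_lt_top),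
    ← integral_const_mul, ← integral_add (integrable_of_continuous hf)
      (integrable_of_continuous (by fun_prop))]
  refine integral_congr_ae (Eventually.of_forall fun x => ?_)
  simp only [ENNReal.toReal_ofReal (ht x).le, smul_eq_mul]
  ring

/-- The linear functional `u ↦ ∫ f u dν` on tangent vectors at `ν`. -/
noncomputable def tangentFunctional (f : Smooth n M) (ν : Dens n M) : densTangent ν →ₗ[ℝ] ℝ where
  toFun u := ∫ x, f x * (u : Smooth n M) x ∂ν.measure
  map_add' u v := by
    refine Eq.trans ?_
      (integral_add ((f * (u : Smooth n M)).integrable ν) ((f * (v : Smooth n M)).integrable ν))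
    exact integral_congr_ae (Eventually.of_forall fun x => mul_add _ _ _)
  map_smul' c u := by
    rw [RingHom.id_apply, smul_eq_mul, ← integral_const_mul]
    exact integral_congr_ae (Eventually.of_forall fun x => mul_left_comm _ _ _)

theorem hasDensDifferential_linFunctional (f : Smooth n M) (ν : Dens n M) :
    HasDensDifferential (linFunctional f) ν (tangentFunctional f ν) := by
  intro u
  refine ⟨ν.curve u, ν.curve_zero u, ?_, ?_⟩
  · filter_upwards [eventually_forall_one_add_mul_pos (u : Smooth n M)] with t ht
    exact ν.curve_measure u ht
  · have h := ((hasDerivAt_id (0 : ℝ)).mul_const (tangentFunctional f ν u)).const_add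
      (linFunctional f ν)
    rw [one_mul] at h
    exact h.congr_of_eventuallyEq (ν.integral_curve u f.contMDiff.continuous)

variable [IsManifold (𝓡 n) ∞ M]

theorem Smooth.eq_zero_of_integral_mul_self {ν : Dens n M} {d : Smooth n M}
    (h : ∫ x, d x * d x ∂ν.measure = 0) : d = 0 := by
  have := ν.isSmoothDensity.isOpenPosMeasure
  have hd := d.contMDiff.continuous
  have h1 := (integral_eq_zero_iff_of_nonneg (fun x => mul_self_nonneg (d x))
    (integrable_of_continuous (by fun_prop))).1 h
  have h2 := (Continuous.ae_eq_iff_eq ν.measure (by fun_prop) continuous_const).1 h1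
  ext x
  exact mul_self_eq_zero.1 (congrFun h2 x)

variable (n M) in
theorem nonempty_dens [T2Space M] [Nonempty M] : Nonempty (Dens n M) := by
  obtain ⟨μ, hf, hμ⟩ := exists_isFiniteMeasure_isSmoothDensity n M
  have := hμ.isOpenPosMeasure
  have h0 : μ univ ≠ 0 := isOpen_univ.measure_ne_zero μ univ_nonempty
  have htop : μ univ ≠ ⊤ := measure_ne_top _ _
  refine ⟨⟨μ.withDensity fun _ => ENNReal.ofReal ((μ univ)⁻¹).toReal,
    hμ.withDensity contMDiff_const fun _ => ?_, ?_⟩⟩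
  · exact ENNReal.toReal_pos (ENNReal.inv_ne_zero.2 htop) (ENNReal.inv_ne_top.2 h0)
  · rw [withDensity_const, Measure.smul_apply, smul_eq_mul,
      ENNReal.ofReal_toReal (ENNReal.inv_ne_top.2 h0), ENNReal.inv_mul_cancel h0 htop]

/-! ### Casimirs of the bracket on densities -/

section

variable [Nonempty (Dens n M)]

/-- A function is determined by its integrals: if the integrals of `d` vanish for all densities, then
differentiating along `(1 + t d) ν` gives `∫ d² dν = 0`. -/
theorem linFunctional_injective :
    Function.Injective (linFunctional : Smooth n M → Dens n M → ℝ) := by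
  intro g g' h
  have hz : ∀ ν : Dens n M, ∫ x, (g - g') x ∂ν.measure = 0 := by
    intro ν
    have := congrFun h ν
    refine (integral_sub (g.integrable ν) (g'.integrable ν)).trans ?_
    exact sub_eq_zero.2 this
  obtain ⟨ν⟩ := ‹Nonempty (Dens n M)›
  have h1 := ν.integral_curve ⟨g - g', hz ν⟩ (g - g').contMDiff.continuous
  obtain ⟨t, ht, ht0⟩ :=
    ((h1.filter_mono nhdsWithin_le_nhds).and (self_mem_nhdsWithin (s := {(0 : ℝ)}ᶜ))).exists
  rw [hz, hz, zero_add, eq_comm, mul_eq_zero] at ht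
  exact sub_eq_zero.1 (Smooth.eq_zero_of_integral_mul_self (ht.resolve_left ht0))

theorem choose_toLin (f : Smooth n M) : (toLin f).2.choose = f :=
  linFunctional_injective (toLin f).2.choose_spec

theorem densBracket_toLin (P : PoissonBracket n M) (f g : Smooth n M) :
    densBracket P (toLin f) (toLin g) = toLin (P.bracket f g) := by
  rw [densBracket, choose_toLin, choose_toLin]

theorem IsDensHamiltonianCurve.linFunctional_eq {P : PoissonBracket n M} {f : ℝ → Smooth n M}
    {c : ℝ → Dens n M} (hc : IsDensHamiltonianCurve P f c) {l : Smooth n M} (hl : P.IsCasimir l) :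
    linFunctional l (c 1) = linFunctional l (c 0) := by
  have hd : ∀ t ∈ Icc (0 : ℝ) 1,
      HasDerivWithinAt (fun s => linFunctional l (c s)) 0 (Icc 0 1) t := by
    intro t ht
    refine (hc.2 l t ht).congr_deriv ?_
    rw [densBracket_toLin, hl]
    exact integral_zero _ _
  exact constant_of_has_deriv_right_zero (fun t ht => (hd t ht).continuousWithinAt)
    (fun t ht => (hd t (Ico_subset_Icc_self ht)).mono_of_mem_nhdsWithin
      (Icc_mem_nhdsGE_of_mem ht)) 1 (right_mem_Icc.2 zero_le_one)

/-- The distribution of a Casimir `l` is the same for all densities on a leaf, since all functions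
`p ∘ l` with `p` polynomial are Casimirs. -/
theorem SameLeaf.map_eq {P : PoissonBracket n M} {l : Smooth n M} (hl : P.IsCasimir l)
    {ν ν' : Dens n M} (h : SameLeaf P ν ν') : ν.measure.map l = ν'.measure.map l := by
  induction h with
  | rel ν ν' h =>
    obtain ⟨f, c, hc, rfl, rfl⟩ := h
    exact map_eq_of_forall_integral_polynomial_eq l.contMDiff.continuous fun p =>
      (hc.linFunctional_eq (hl.comp (contDiff_polynomial_eval p))).symm
  | refl ν => rfl
  | symm ν ν' _ ih => exact ih.symm
  | trans ν ν' ν'' _ _ ih ih' => exact ih.trans ih'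

end

/-! ### Functional independence -/

/-- If `u ↦ ∫ f u dν` vanishes on tangent vectors, then `f` is constant, as is seen by taking
for `u` the deviation of `f` from its mean. -/
theorem eq_const_of_tangentFunctional_eq_zero {f : Smooth n M} {ν : Dens n M}
    (h : tangentFunctional f ν = 0) : ∃ c, ∀ x, f x = c := by
  let c := ∫ x, f x ∂ν.measure
  let u : Smooth n M := f - c • (1 : Smooth n M)
  have hux : ∀ x, u x = f x - c * 1 := fun x => rfl
  have hu : ∫ x, u x ∂ν.measure = 0 := by
    simp_rw [hux]
    rw [integral_sub (f.integrable ν) (integrable_const _)]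
    simp [c]
  have h1 : ∫ x, f x * u x ∂ν.measure = 0 := DFunLike.congr_fun h (⟨u, hu⟩ : densTangent ν)
  have h2 : ∫ x, u x * u x ∂ν.measure = 0 := by
    have : ∀ x, u x * u x = f x * u x - c * u x := fun x => by rw [hux]; ring
    simp_rw [this]
    have hfu : Integrable (fun x => f x * u x) ν.measure := (f * u).integrable ν
    rw [integral_sub hfu ((u.integrable ν).const_mul c), h1, integral_const_mul, hu]
    simp
  refine ⟨c, fun x => ?_⟩
  have h3 := DFunLike.congr_fun (Smooth.eq_zero_of_integral_mul_self h2) x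
  rw [hux] at h3
  have h4 : f x - c * 1 = 0 := h3
  linarith

theorem infinite_range_of_not_isLocallyConstant {X Y : Type*} [TopologicalSpace X]
    [TopologicalSpace Y] [T1Space Y] {f : X → Y} (hf : Continuous f) (h : ¬ IsLocallyConstant f) :
    (range f).Infinite := by
  intro hfin
  refine h fun s => ?_
  have h1 : f ⁻¹' s = (f ⁻¹' (sᶜ ∩ range f))ᶜ := by
    ext x; simp
  rw [h1]
  exact ((hfin.subset inter_subset_right).isClosed.preimage hf).isOpen_compl

/-- The powers `l, l², l³, …` of a function with infinitely many values give functionally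
independent linear functionals: a linear relation between the differentials makes a polynomial
without constant term constant on the range of `l`. -/
theorem functionallyIndependent_pow {l : Smooth n M} (hl : (range l).Infinite) :
    FunctionallyIndependent fun i : ℕ =>
      casimirFunctional (n := n) (M := M) (fun s => s ^ (i + 1)) l := by
  have hs : ∀ i : ℕ, ContDiff ℝ ∞ fun s : ℝ => s ^ (i + 1) := fun i => contDiff_id.pow _
  intro ν
  refine ⟨fun i => tangentFunctional (compSmooth (hs i) l) ν, fun i =>
    hasDensDifferential_linFunctional (compSmooth (hs i) l) ν, ?_⟩
  rw [linearIndependent_iff']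
  intro s a h i hi
  let p : Polynomial ℝ := ∑ j ∈ s, Polynomial.C (a j) * Polynomial.X ^ (j + 1)
  have hp : tangentFunctional (compSmooth (contDiff_polynomial_eval p) l) ν = 0 := by
    rw [← h]
    ext u
    have hi : ∀ j ∈ s, Integrable (fun x => a j * (l x ^ (j + 1) * (u : Smooth n M) x)) ν.measure :=
      fun j _ => ((compSmooth (hs j) l * (u : Smooth n M)).integrable ν).const_mul (a j)
    rw [LinearMap.sum_apply]
    change ∫ x, p.eval (l x) * (u : Smooth n M) x ∂ν.measure
      = ∑ j ∈ s, a j * ∫ x, l x ^ (j + 1) * (u : Smooth n M) x ∂ν.measure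
    simp_rw [← integral_const_mul]
    rw [← integral_finsetSum s hi]
    refine integral_congr_ae (Eventually.of_forall fun x => ?_)
    simp only [p, Polynomial.eval_finsetSum, Polynomial.eval_mul, Polynomial.eval_C,
      Polynomial.eval_pow, Polynomial.eval_X, Finset.sum_mul, mul_assoc]
  obtain ⟨c, hc⟩ := eq_const_of_tangentFunctional_eq_zero hp
  have hpc : p = Polynomial.C c := by
    refine Polynomial.eq_of_infinite_eval_eq p _ (hl.mono ?_)
    rintro _ ⟨x, rfl⟩
    simpa using hc x
  have hcoeff := congrArg (fun q => q.coeff (i + 1)) hpc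
  simpa [p, Polynomial.finsetSum_coeff, Polynomial.coeff_C_mul, Polynomial.coeff_X_pow,
    Polynomial.coeff_C, hi] using hcoeff

end

end PoissonDens

theorem mainTheorem2 {n : ℕ} {M : Type*} [TopologicalSpace M] [T2Space M] [CompactSpace M]
    [ChartedSpace (EuclideanSpace ℝ (Fin n)) M] [IsManifold (𝓡 n) ∞ M]
    [MeasurableSpace M] [BorelSpace M]
    (P : PoissonDens.PoissonBracket n M)
    (hcodim : ∀ x : M, 1 ≤ P.leafCodim x)
    (l : PoissonDens.Smooth n M) (hl : P.IsCasimir l)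
    (hconst : ∃ x y : M, l x ≠ l y) :
    -- there are densities
    Nonempty (PoissonDens.Dens n M) ∧
    -- for every `h`, the functional is constant on the symplectic leaves of the bracket on
    -- densities and on the orbits of the Hamiltonian diffeomorphism group
    -- (and so is its domain of definition)
    (∀ (h : ℝ → ℝ) (ν ν' : PoissonDens.Dens n M),
      PoissonDens.SameLeaf P ν ν' ∨ PoissonDens.SameOrbit P ν ν' →
        (Integrable (fun x => h (l x)) ν.measure ↔ Integrable (fun x => h (l x)) ν'.measure) ∧
        PoissonDens.casimirFunctional h l ν = PoissonDens.casimirFunctional h l ν') ∧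
    -- if `h` is Borel and locally bounded, the functional is defined everywhere
    (∀ h : ℝ → ℝ, Measurable h → (∀ K : Set ℝ, IsCompact K → Bornology.IsBounded (h '' K)) →
      ∀ ν : PoissonDens.Dens n M, Integrable (fun x => h (l x)) ν.measure) ∧
    -- if `h` is smooth, the functional is one of the `F_f` and its bracket with each `F_g` is zero
    (∀ h : ℝ → ℝ, ContDiff ℝ ∞ h →
      ∃ Φ : PoissonDens.linFunctionals n M,
        (Φ : PoissonDens.Dens n M → ℝ) = PoissonDens.casimirFunctional h l ∧
        ∀ (Ψ : PoissonDens.linFunctionals n M) (ν : PoissonDens.Dens n M),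
          (PoissonDens.densBracket P Φ Ψ : PoissonDens.Dens n M → ℝ) ν = 0) ∧
    -- infinitely many of these functionals are functionally independent
    (¬ IsLocallyConstant l →
      ∃ h : ℕ → ℝ → ℝ, (∀ i, ContDiff ℝ ∞ (h i)) ∧
        PoissonDens.FunctionallyIndependent
          (fun i => PoissonDens.casimirFunctional (h i) l)) := by

  have : Nonempty M := let ⟨x, _⟩ := hconst; ⟨x⟩
  have hne := PoissonDens.nonempty_dens n M
  have := ChartedSpace.secondCountable_of_sigmaCompact (EuclideanSpace ℝ (Fin n)) M
  have hlc : Continuous l := l.contMDiff.continuous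
  refine ⟨hne, fun h ν ν' hν => ?_, fun h hm hb ν => ?_, fun h hh => ?_, fun hloc => ?_⟩
  · have hmap : ν.measure.map l = ν'.measure.map l :=
      hν.elim (fun H => H.map_eq hl) (fun H => H.map_eq hl)
    rw [PoissonDens.integrable_comp_iff_map hlc, PoissonDens.integrable_comp_iff_map hlc,
      PoissonDens.casimirFunctional, PoissonDens.casimirFunctional,
      PoissonDens.integral_comp_eq_map hlc, PoissonDens.integral_comp_eq_map hlc, hmap]
    exact ⟨Iff.rfl, rfl⟩
  · obtain ⟨B, hB⟩ := (hb _ (isCompact_range hlc)).exists_norm_le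
    exact Integrable.of_bound (hm.comp hlc.measurable).aestronglyMeasurable B
      (Eventually.of_forall fun x => hB _ (mem_image_of_mem h (mem_range_self x)))
  · refine ⟨PoissonDens.toLin (PoissonDens.compSmooth hh l), rfl, ?_⟩
    rintro ⟨_, g, rfl⟩ ν
    have := PoissonDens.densBracket_toLin P (PoissonDens.compSmooth hh l) g
    rw [hl.comp hh] at this
    exact (congrArg (fun Φ : PoissonDens.linFunctionals n M => (Φ : _ → ℝ) ν) this).trans
      (integral_zero _ _)
  · exact ⟨fun i s => s ^ (i + 1), fun i => contDiff_id.pow _,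
      PoissonDens.functionallyIndependent_pow
        (PoissonDens.infinite_range_of_not_isLocallyConstant hlc hloc)⟩
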